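/- Fix a separable infinite-dimensional complex Hilbert space $L$; let $\mathcal{B}$ and $\mathcal{K}$ be the algebras of all bounded, respectively compact, operators on $L$. For a complex linear space $E$ let $\mathcal{K}E:=\mathcal{K}\otimes E$ (algebraic tensor product; write $ax$ for $a\otimes x$), a $\mathcal{B}$-bimodule with $a\cdot bx=(ab)x$, $bx\cdot a=(ba)x$. A quantum norm on $E$ is a norm on $\mathcal{K}E$ such that (RI) $\|a\cdot u\|,\|u\cdot a\|\le\|a\|\|u\|$ for $a\in\mathcal{B}$, $u\in\mathcal{K}E$; and (RII) $\|u+v\|=\max\{\|u\|,\|v\|\}$ whenever there are self-adjoint idempotents $P,Q\in\mathcal{B}$ with $PQ=0$, $P\cdot u=u=u\cdot P$ and $Q\cdot v=v=v\cdot Q$. A quantum space is a complex linear space with a quantum norm. A linear operator $\varphi:E\to F$ between quantum spaces is completely bounded if $\varphi_\infty:=\mathbf{1}_{\mathcal K}\otimes\varphi:\mathcal{K}E\to\mathcal{K}F$ is bounded, $\|\varphi\|_{cb}:=\|\varphi_\infty\|$, and $\varphi$ is completely contractive if $\|\varphi\|_{cb}\le1$. A bilinear operator $\mathcal{R}:E\times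 F\to G$ between quantum spaces is strongly completely bounded if the bilinear operator $\mathcal{R}_s:\mathcal{K}E\times\mathcal{K}F\to\mathcal{K}G$ determined by $(ax,by)\mapsto(ab)\mathcal{R}(x,y)$ is bounded, $\|\mathcal{R}\|_{scb}:=\|\mathcal{R}_s\|$, and $\mathcal{R}$ is strongly completely contractive if $\|\mathcal{R}\|_{scb}\le1$. Let $E$ and $F$ be quantum spaces, let $\vartheta:E\times F\to E\otimes F$, $(x,y)\mapsto x\otimes y$, be the canonical bilinear operator, and let $\odot:\mathcal{K}E\otimes\mathcal{K}F\to\mathcal{K}(E\otimes F)$ be the linear operator (Effros symbol) determined by $ax\otimes by\mapsto(ab)(x\otimes y)$. Then $\odot$ is surjective. Let $\|\cdot\|_h$, the Haagerup seminorm, be the quotient under $\odot$ of the projective norm $\|t\|_p=\inf\{\sum_{k=1}^n\|u_k\|\|v_k\| : t=\sum_{k=1}^n u_k\otimes v_k\}$, i.e. $\|U\|_h=\inf\{\|t\|_p : \odot(t)=U\}$. The following hold. (a) $\|\cdot\|_h$ is a quantum norm on $E\otimes F$. Denote the resulting quantum space by $E\otimes_hF$. (b) For every quantum space $G$ and every strongly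 completely bounded bilinear operator $\mathcal{R}:E\times F\to G$ there is a unique completely bounded linear operator $R:E\otimes_hF\to G$ with $R(x\otimes y)=\mathcal{R}(x,y)$ for all $x\in E$, $y\in F$; moreover $\|R\|_{cb}=\|\mathcal{R}\|_{scb}$. (c) $(E\otimes_hF,\vartheta)$ is the Haagerup tensor product of $E$ and $F$: $\vartheta:E\times F\to E\otimes_hF$ is strongly completely contractive, and for every quantum space $G$ and every strongly completely contractive bilinear operator $\mathcal{R}:E\times F\to G$ there is a unique completely contractive linear operator $R:E\otimes_hF\to G$ with $R\circ\vartheta=\mathcal{R}$. -/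

import Mathlib

open scoped TensorProduct

namespace QuantumSpace

noncomputable section

/-! Throughout, `L` is the fixed Hilbert space, `L →L[ℂ] L` is the algebra of all bounded
operators on `L`, and `Cpt L` is the algebra of all compact operators on `L`. -/

section Compact

variable (L : Type*) [NormedAddCommGroup L] [InnerProductSpace ℂ L]

/-- The space of compact operators on `L`, as a subspace of the bounded operators. -/
abbrev Cpt : Submodule ℂ (L →L[ℂ] L) := compactOperator (RingHom.id ℂ) L L

variable {L}

theorem comp_mem_cpt_left (a : L →L[ℂ] L) {b : L →L[ℂ] L} (hb : b ∈ Cpt L) :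
    a * b ∈ Cpt L :=
  IsCompactOperator.clm_comp (f := b) hb a

theorem comp_mem_cpt_right (a : L →L[ℂ] L) {b : L →L[ℂ] L} (hb : b ∈ Cpt L) :
    b * a ∈ Cpt L :=
  IsCompactOperator.comp_clm (f := b) hb a

/-- Left multiplication `b ↦ a b` of compact operators by a bounded operator `a`. -/
def cptMulLeft (a : L →L[ℂ] L) : Cpt L →ₗ[ℂ] Cpt L where
  toFun b := ⟨a * b.1, comp_mem_cpt_left a b.2⟩
  map_add' b c := Subtype.ext (mul_add a b.1 c.1)
  map_smul' r b := Subtype.ext (mul_smul_comm r a b.1)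

/-- Right multiplication `b ↦ b a` of compact operators by a bounded operator `a`. -/
def cptMulRight (a : L →L[ℂ] L) : Cpt L →ₗ[ℂ] Cpt L where
  toFun b := ⟨b.1 * a, comp_mem_cpt_right a b.2⟩
  map_add' b c := Subtype.ext (add_mul b.1 c.1 a)
  map_smul' r b := Subtype.ext (smul_mul_assoc r b.1 a)

variable (L)

/-- The bilinear multiplication `(a, b) ↦ a b` of compact operators. -/
def cptMul : Cpt L →ₗ[ℂ] Cpt L →ₗ[ℂ] Cpt L :=
  LinearMap.mk₂ ℂ (fun a b => ⟨a.1 * b.1, comp_mem_cpt_left a.1 b.2⟩)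
    (fun a b c => Subtype.ext (add_mul a.1 b.1 c.1))
    (fun r a b => Subtype.ext (smul_mul_assoc r a.1 b.1))
    (fun a b c => Subtype.ext (mul_add a.1 b.1 c.1))
    (fun r a b => Subtype.ext (mul_smul_comm r a.1 b.1))

/-- The amplification of a linear space `E`: the algebraic tensor product of the space of
compact operators on `L` with `E`. -/
abbrev Amp (E : Type*) [AddCommGroup E] [Module ℂ E] : Type _ := Cpt L ⊗[ℂ] E

end Compact

section Maps

variable {L : Type*} [NormedAddCommGroup L] [InnerProductSpace ℂ L]
variable {E : Type*} [AddCommGroup E] [Module ℂ E]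
variable {F : Type*} [AddCommGroup F] [Module ℂ F]
variable {G : Type*} [AddCommGroup G] [Module ℂ G]

/-- The left outer multiplication `a · (b ⊗ x) = (a b) ⊗ x` by a bounded operator `a`. -/
def lmul (a : L →L[ℂ] L) : Amp L E →ₗ[ℂ] Amp L E := LinearMap.rTensor E (cptMulLeft a)

/-- The right outer multiplication `(b ⊗ x) · a = (b a) ⊗ x` by a bounded operator `a`. -/
def rmul (a : L →L[ℂ] L) : Amp L E →ₗ[ℂ] Amp L E := LinearMap.rTensor E (cptMulRight a)

variable (L)

/-- The amplification of a linear operator `φ`: the operator `a ⊗ x ↦ a ⊗ φ x`. -/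
def amp (φ : E →ₗ[ℂ] F) : Amp L E →ₗ[ℂ] Amp L F := LinearMap.lTensor (Cpt L) φ

/-- The strong amplification of a bilinear operator `R`: the bilinear operator with
`(a ⊗ x, b ⊗ y) ↦ (a b) ⊗ R (x, y)`. -/
def strongAmp (R : E →ₗ[ℂ] F →ₗ[ℂ] G) : Amp L E →ₗ[ℂ] Amp L F →ₗ[ℂ] Amp L G :=
  TensorProduct.map₂ (cptMul L) R

theorem strongAmp_tmul (R : E →ₗ[ℂ] F →ₗ[ℂ] G) (a b : Cpt L) (x : E) (y : F) :
    strongAmp L R (a ⊗ₜ x) (b ⊗ₜ y) = (cptMul L a b) ⊗ₜ R x y := by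
  simp [strongAmp]

variable (E F)

/-- The linearized Effros symbol: the linear operator associated with the strong amplification
of the canonical bilinear operator `(x, y) ↦ x ⊗ y`, so that
`(a ⊗ x) ⊗ (b ⊗ y) ↦ (a b) ⊗ (x ⊗ y)`. -/
def effros : Amp L E ⊗[ℂ] Amp L F →ₗ[ℂ] Amp L (E ⊗[ℂ] F) :=
  TensorProduct.lift (strongAmp L (TensorProduct.mk ℂ E F))

end Maps

section Ruan

variable {L : Type*} [NormedAddCommGroup L] [InnerProductSpace ℂ L] [CompleteSpace L]
variable {E : Type*} [AddCommGroup E] [Module ℂ E]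

/-- The first axiom of Ruan. -/
def RuanI (N : Amp L E → ℝ) : Prop :=
  ∀ (a : L →L[ℂ] L) (u : Amp L E), N (lmul a u) ≤ ‖a‖ * N u ∧ N (rmul a u) ≤ ‖a‖ * N u

/-- `P` is a (two-sided) support of `u`: a self-adjoint idempotent with `P · u = u = u · P`. -/
def IsSupport (P : L →L[ℂ] L) (u : Amp L E) : Prop :=
  IsStarProjection P ∧ lmul P u = u ∧ rmul P u = u

/-- The second axiom of Ruan. -/
def RuanII (N : Amp L E → ℝ) : Prop :=
  ∀ (u v : Amp L E) (P Q : L →L[ℂ] L), IsSupport P u → IsSupport Q v → P * Q = 0 →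
    N (u + v) = max (N u) (N v)

/-- A quantum norm on `E`: a norm on the amplification of `E` satisfying both axioms of Ruan. -/
structure IsQuantumNorm (N : Amp L E → ℝ) : Prop where
  nonneg : ∀ u, 0 ≤ N u
  add_le : ∀ u v, N (u + v) ≤ N u + N v
  smul : ∀ (c : ℂ) u, N (c • u) = ‖c‖ * N u
  eq_zero : ∀ u, N u = 0 → u = 0
  ruanI : RuanI N
  ruanII : RuanII N

end Ruan

section Bounded

variable {L : Type*} [NormedAddCommGroup L] [InnerProductSpace ℂ L]
variable {E : Type*} [AddCommGroup E] [Module ℂ E]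
variable {F : Type*} [AddCommGroup F] [Module ℂ F]
variable {G : Type*} [AddCommGroup G] [Module ℂ G]

/-- `C ≥ 0` is a bound for the amplification of `φ`. -/
def CBBound (nE : Amp L E → ℝ) (nF : Amp L F → ℝ) (φ : E →ₗ[ℂ] F) (C : ℝ) : Prop :=
  0 ≤ C ∧ ∀ u, nF (amp L φ u) ≤ C * nE u

/-- `φ` is completely bounded: its amplification is a bounded operator. -/
def IsCB (nE : Amp L E → ℝ) (nF : Amp L F → ℝ) (φ : E →ₗ[ℂ] F) : Prop :=
  ∃ C, CBBound nE nF φ C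

/-- The completely bounded norm: the operator norm of the amplification. -/
def cbNorm (nE : Amp L E → ℝ) (nF : Amp L F → ℝ) (φ : E →ₗ[ℂ] F) : ℝ :=
  sInf {C | CBBound nE nF φ C}

/-- `φ` is completely contractive. -/
def IsCC (nE : Amp L E → ℝ) (nF : Amp L F → ℝ) (φ : E →ₗ[ℂ] F) : Prop :=
  ∀ u, nF (amp L φ u) ≤ nE u

/-- `C ≥ 0` is a bound for the strong amplification of `R`. -/
def SCBBound (nE : Amp L E → ℝ) (nF : Amp L F → ℝ) (nG : Amp L G → ℝ)
    (R : E →ₗ[ℂ] F →ₗ[ℂ] G) (C : ℝ) : Prop :=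
  0 ≤ C ∧ ∀ u v, nG (strongAmp L R u v) ≤ C * nE u * nF v

/-- `R` is strongly completely bounded: its strong amplification is a bounded bilinear operator. -/
def IsSCB (nE : Amp L E → ℝ) (nF : Amp L F → ℝ) (nG : Amp L G → ℝ)
    (R : E →ₗ[ℂ] F →ₗ[ℂ] G) : Prop :=
  ∃ C, SCBBound nE nF nG R C

/-- The strong completely bounded norm: the bilinear operator norm of the strong amplification. -/
def scbNorm (nE : Amp L E → ℝ) (nF : Amp L F → ℝ) (nG : Amp L G → ℝ)
    (R : E →ₗ[ℂ] F →ₗ[ℂ] G) : ℝ :=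
  sInf {C | SCBBound nE nF nG R C}

/-- `R` is strongly completely contractive. -/
def IsSCC (nE : Amp L E → ℝ) (nF : Amp L F → ℝ) (nG : Amp L G → ℝ)
    (R : E →ₗ[ℂ] F →ₗ[ℂ] G) : Prop :=
  ∀ u v, nG (strongAmp L R u v) ≤ nE u * nF v

end Bounded

section Haagerup

/-- The projective (semi-)norm on `X ⊗ Y` of (semi-)norms `nX` on `X` and `nY` on `Y`. -/
def projNorm {X Y : Type*} [AddCommGroup X] [Module ℂ X] [AddCommGroup Y] [Module ℂ Y]
    (nX : X → ℝ) (nY : Y → ℝ) (t : X ⊗[ℂ] Y) : ℝ :=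
  sInf {r | ∃ (n : ℕ) (x : Fin n → X) (y : Fin n → Y),
    t = ∑ k, x k ⊗ₜ[ℂ] y k ∧ r = ∑ k, nX (x k) * nY (y k)}

variable {L : Type*} [NormedAddCommGroup L] [InnerProductSpace ℂ L]
variable {E : Type*} [AddCommGroup E] [Module ℂ E]
variable {F : Type*} [AddCommGroup F] [Module ℂ F]

/-- The Haagerup seminorm on the amplification of `E ⊗ F`: the quotient of the projective norm
under the linearized Effros symbol. -/
def haagerup (nE : Amp L E → ℝ) (nF : Amp L F → ℝ) (U : Amp L (E ⊗[ℂ] F)) : ℝ :=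
  sInf (projNorm nE nF '' {t | effros L E F t = U})

end Haagerup

/-- The pair of the quantum space `(T, nT)` and the bilinear operator `θ : E × F → T` is the
Haagerup tensor product of the quantum spaces `(E, nE)` and `(F, nF)`: `θ` is strongly completely
contractive, and every strongly completely contractive bilinear operator from `E × F` to a quantum
space factors through `θ` by a unique completely contractive operator. -/
def IsHaagerupTensorProduct.{w, uL, uE, uF, uT}
    {L : Type uL} [NormedAddCommGroup L] [InnerProductSpace ℂ L] [CompleteSpace L]
    {E : Type uE} [AddCommGroup E] [Module ℂ E]
    {F : Type uF} [AddCommGroup F] [Module ℂ F]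
    {T : Type uT} [AddCommGroup T] [Module ℂ T]
    (nE : Amp L E → ℝ) (nF : Amp L F → ℝ) (nT : Amp L T → ℝ) (θ : E →ₗ[ℂ] F →ₗ[ℂ] T) : Prop :=
  IsQuantumNorm nT ∧ IsSCC nE nF nT θ ∧
    ∀ (G : Type w) [AddCommGroup G] [Module ℂ G] (nG : Amp L G → ℝ), IsQuantumNorm nG →
      ∀ R : E →ₗ[ℂ] F →ₗ[ℂ] G, IsSCC nE nF nG R →
        ∃! S : T →ₗ[ℂ] G, IsCC nT nG S ∧ ∀ x y, S (θ x y) = R x y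

end

end QuantumSpace

universe w uL uE uF uG

/-! The Haagerup seminorm of `U` is the infimum of `‖u‖ ‖v‖` over all representations of `U` by a
*single* pair, `U = u ⊙ v`, where `u ⊙ v` is the strong amplification of the canonical bilinear
operator. As `L` is infinite-dimensional, it carries isometries `S`, `T` with orthogonal ranges, and
`u₁ ⊙ v₁ + u₂ ⊙ v₂ = (u₁ · S⋆ + u₂ · T⋆) ⊙ (S · v₁ + T · v₂)`. The row on the left is the diagonal
`S · u₁ · S⋆ + T · u₂ · T⋆`, whose norm is `max ‖u₁‖ ‖u₂‖` by the second axiom of Ruan, multiplied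
by bounded operators; so its norm is at most `√(‖u₁‖² + ‖u₂‖²)`, and similarly for the column.
After rescaling the factors (`exists_balanced`), two summands merge into one without loss
(`exists_strongAmp_add`), which gives `exists_of_haagerup_lt` and `le_mul_haagerup`.

The triangle inequality and the first axiom of Ruan follow at once. For the second axiom, with
supports `P` and `Q`, the same row and column are formed from `P · u₁`, `Q · u₂` and `v₁ · P`,
`v₂ · Q`; since `P + Q` is a projection, their norms are at most the maxima of the norms of the
entries.

For definiteness, a functional on a quantum space that is bounded for the norm `x ↦ ‖p ⊗ x‖`, `p` a
rank-one projection, is completely bounded (`norm_slice_le`): the matrix coefficients of its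
amplification at `u` are its values on rank-one compressions of `u`. Amplifying `f ⊗ g` turns
`u ⊙ v` into the product of the amplifications of `f` at `u` and of `g` at `v`, so it is bounded for
the Haagerup seminorm, and by the Hahn–Banach theorem such functionals separate the points.

The Effros symbol is surjective because every compact operator is a sum of products of two compact
operators (`cpt_le_cptSq`). The universal property holds since a bilinear operator and its
linearization have the same bounds (`cbBound_lift_iff`). -/

open scoped TensorProduct

namespace QuantumSpace

open ContinuousLinearMap

/-! ### Products of compact operators -/

section CompactFactorization

variable {L : Type*} [NormedAddCommGroup L] [InnerProductSpace ℂ L] [CompleteSpace L]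

/-- A bounded operator `T` is compact as soon as `T⋆ T` is: on the unit ball
`‖T (x - y)‖² ≤ 2 ‖T⋆ T x - T⋆ T y‖`, so that `T` maps it to a totally bounded set. -/
theorem mem_cpt_of_star_mul_self {T : L →L[ℂ] L} (h : star T * T ∈ Cpt L) : T ∈ Cpt L := by
  change IsCompactOperator T.toLinearMap
  have h' : IsCompactOperator (star T * T : L →L[ℂ] L) := h
  rw [isCompactOperator_iff_isCompact_closure_image_ball (𝕜₁ := ℂ) T.toLinearMap one_pos]
  refine TotallyBounded.isCompact_of_isClosed (TotallyBounded.closure ?_) isClosed_closure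
  have hK := (h'.isCompact_closure_image_ball (f := (star T * T : L →L[ℂ] L).toLinearMap)
    1).totallyBounded.subset subset_closure
  rw [Metric.totallyBounded_iff]
  intro ε hε
  obtain ⟨t, hts, htf, ht⟩ := Metric.finite_approx_of_totallyBounded hK (ε ^ 2 / 2) (by positivity)
  obtain ⟨s, hs, rfl, hsf⟩ : ∃ s ⊆ Metric.ball (0 : L) 1,
      (star T * T : L →L[ℂ] L) '' s = t ∧ s.Finite := by
    obtain ⟨s, hs, hst⟩ := Set.subset_image_iff.mp hts
    obtain ⟨s', hs', hb⟩ := Set.SurjOn.exists_bijOn_subset (f := (star T * T : L →L[ℂ] L))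
      (s := s) (t := t) hst.symm.subset
    exact ⟨s', hs'.trans hs, hb.image_eq, (hb.finite_iff_finite).mpr htf⟩
  refine ⟨T '' s, hsf.image T, ?_⟩
  rintro _ ⟨x, hx, rfl⟩
  have := ht ⟨x, hx, rfl⟩
  simp only [Set.biUnion_image, Set.mem_iUnion, Metric.mem_ball] at this ⊢
  obtain ⟨y, hy, hxy⟩ := this
  refine ⟨y, hy, ?_⟩
  change dist (T x) (T y) < ε
  change dist ((star T * T) x) ((star T * T) y) < _ at hxy
  rw [dist_eq_norm, ← map_sub] at hxy ⊢
  have hx1 : ‖x‖ < 1 := by simpa using hx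
  have hy1 : ‖y‖ < 1 := by simpa using hs hy
  have h2 : ‖x - y‖ ≤ 2 := (norm_sub_le x y).trans (by linarith)
  have h3 : ‖T (x - y)‖ ^ 2 ≤ ‖(star T * T) (x - y)‖ * ‖x - y‖ := by
    have := apply_norm_sq_eq_inner_adjoint_left T (x - y)
    rw [this]
    exact (Complex.re_le_norm _).trans (norm_inner_le_norm _ _)
  refine lt_of_pow_lt_pow_left₀ 2 hε.le (h3.trans_lt ?_)
  nlinarith [norm_nonneg ((star T * T) (x - y)), norm_nonneg (x - y)]

theorem star_mem_cpt {T : L →L[ℂ] L} (h : T ∈ Cpt L) : star T ∈ Cpt L := by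
  apply mem_cpt_of_star_mul_self
  rw [star_star]
  exact comp_mem_cpt_right _ h

variable (L) in
/-- The span of the products of two compact operators. -/
def cptSq : Submodule ℂ (L →L[ℂ] L) :=
  Submodule.span ℂ {c | ∃ a b : Cpt L, c = a.1 * b.1}

theorem mem_cptSq_of_nonneg {c : L →L[ℂ] L} (hc : c ∈ Cpt L) (h0 : 0 ≤ c) : c ∈ cptSq L := by
  have hs : CFC.sqrt c * CFC.sqrt c = c := CFC.sqrt_mul_sqrt_self c
  have hm : CFC.sqrt c ∈ Cpt L := by
    apply mem_cpt_of_star_mul_self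
    rwa [(CFC.sqrt_nonneg c).isSelfAdjoint.star_eq, hs]
  exact Submodule.subset_span ⟨⟨_, hm⟩, ⟨_, hm⟩, hs.symm⟩

theorem mem_cptSq_of_isSelfAdjoint {c : L →L[ℂ] L} (hc : c ∈ Cpt L) (h : IsSelfAdjoint c) :
    c ∈ cptSq L := by
  have ha : CFC.abs c ∈ Cpt L := by
    apply mem_cpt_of_star_mul_self
    rw [(CFC.abs_nonneg c).isSelfAdjoint.star_eq, CFC.abs_mul_abs]
    exact comp_mem_cpt_left _ hc
  have hp : c⁺ ∈ Cpt L := by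
    have : c⁺ = (2⁻¹ : ℂ) • (CFC.abs c + c) := by
      rw [CFC.abs_add_self c h, ← Nat.cast_smul_eq_nsmul ℂ, smul_smul]; norm_num
    rw [this]; exact Submodule.smul_mem _ _ (add_mem ha hc)
  have hn : c⁻ ∈ Cpt L := by
    have : c⁻ = c⁺ - c := by
      nth_rw 3 [← CFC.posPart_sub_negPart c h]; abel
    rw [this]; exact sub_mem hp hc
  rw [← CFC.posPart_sub_negPart c h]
  exact sub_mem (mem_cptSq_of_nonneg hp (CFC.posPart_nonneg c))
    (mem_cptSq_of_nonneg hn (CFC.negPart_nonneg c))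

/-- Every compact operator is a sum of products of two compact operators: split it into real and
imaginary, positive and negative parts, and take square roots. -/
theorem cpt_le_cptSq : Cpt L ≤ cptSq L := by
  intro c hc
  rw [← realPart_add_I_smul_imaginaryPart c]
  have hs := star_mem_cpt hc
  refine add_mem (mem_cptSq_of_isSelfAdjoint ?_ (realPart c).2)
    (Submodule.smul_mem _ _ (mem_cptSq_of_isSelfAdjoint ?_ (imaginaryPart c).2))
  · rw [realPart_apply_coe, ← Complex.coe_smul]
    exact Submodule.smul_mem _ _ (add_mem hc hs)
  · rw [imaginaryPart_apply_coe, ← Complex.coe_smul]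
    exact Submodule.smul_mem _ _ (Submodule.smul_mem _ _ (sub_mem hc hs))

variable (L) in
theorem span_cptMul :
    Submodule.span ℂ {c : Cpt L | ∃ a b : Cpt L, c = cptMul L a b} = ⊤ := by
  rw [eq_top_iff]
  rintro ⟨c, hc⟩ -
  suffices h : ∀ c ∈ cptSq L, ∃ d ∈ Submodule.span ℂ {c : Cpt L | ∃ a b : Cpt L,
      c = cptMul L a b}, d.1 = c by
    obtain ⟨d, hd, rfl⟩ := h c (cpt_le_cptSq hc)
    exact hd
  intro c hc
  induction hc using Submodule.span_induction with
  | mem c h => obtain ⟨a, b, rfl⟩ := h; exact ⟨_, Submodule.subset_span ⟨a, b, rfl⟩, rfl⟩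
  | zero => exact ⟨0, zero_mem _, rfl⟩
  | add x y _ _ hx hy =>
    obtain ⟨d, hd, rfl⟩ := hx
    obtain ⟨e, he, rfl⟩ := hy
    exact ⟨d + e, add_mem hd he, rfl⟩
  | smul r x _ hx =>
    obtain ⟨d, hd, rfl⟩ := hx
    exact ⟨r • d, Submodule.smul_mem _ _ hd, rfl⟩

omit [CompleteSpace L] in
theorem effros_tmul {E F : Type*} [AddCommGroup E] [Module ℂ E] [AddCommGroup F] [Module ℂ F]
    (u : Amp L E) (v : Amp L F) :
    effros L E F (u ⊗ₜ v) = strongAmp L (TensorProduct.mk ℂ E F) u v := by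
  simp [effros]

theorem effros_surjective (E F : Type*) [AddCommGroup E] [Module ℂ E] [AddCommGroup F]
    [Module ℂ F] : Function.Surjective (effros L E F) := by
  rw [← LinearMap.range_eq_top, eq_top_iff]
  rintro U -
  induction U using TensorProduct.induction_on with
  | zero => exact zero_mem _
  | add U V hU hV => exact add_mem hU hV
  | tmul c z =>
    have hc : c ∈ Submodule.span ℂ {c : Cpt L | ∃ a b : Cpt L, c = cptMul L a b} := by
      rw [span_cptMul]; trivial
    induction hc using Submodule.span_induction with
    | zero => rw [TensorProduct.zero_tmul]; exact zero_mem _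
    | add x y _ _ hx hy => rw [TensorProduct.add_tmul]; exact add_mem hx hy
    | smul r x _ hx => rw [← TensorProduct.smul_tmul']; exact Submodule.smul_mem _ _ hx
    | mem c h =>
      obtain ⟨a, b, rfl⟩ := h
      induction z using TensorProduct.induction_on with
      | zero => rw [TensorProduct.tmul_zero]; exact zero_mem _
      | add x y hx hy => rw [TensorProduct.tmul_add]; exact add_mem hx hy
      | tmul x y =>
        exact ⟨(a ⊗ₜ x) ⊗ₜ (b ⊗ₜ y), by rw [effros_tmul, strongAmp_tmul]; rfl⟩

end CompactFactorization

/-! ### Isometries with orthogonal ranges -/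

section Isometries

variable {L : Type*} [NormedAddCommGroup L] [InnerProductSpace ℂ L] [CompleteSpace L]

/-- An infinite-dimensional Hilbert space carries two isometries with orthogonal ranges: an
orthonormal basis can be split into two parts, each equipotent to the whole. -/
theorem exists_isometries (hL : ¬ FiniteDimensional ℂ L) :
    ∃ S T : L →L[ℂ] L, star S * S = 1 ∧ star T * T = 1 ∧ star S * T = 0 := by
  obtain ⟨w, b, -⟩ := exists_hilbertBasis ℂ L
  have hw : Infinite w := by
    by_contra h
    rw [not_infinite_iff_finite] at h
    have := Fintype.ofFinite w
    exact hL (b.toOrthonormalBasis.toBasis.finiteDimensional_of_finite)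
  obtain ⟨σ⟩ : Nonempty (w ⊕ w ≃ w) := by
    rw [← Cardinal.eq, Cardinal.mk_sum, Cardinal.lift_id]
    exact Cardinal.add_eq_self (Cardinal.aleph0_le_mk w)
  classical
  have key : ∀ τ : w → w, Function.Injective τ →
      ∃ S : L →ₗᵢ[ℂ] L, ∀ i, S (b i) = b (τ i) := fun τ hτ => by
    refine ⟨((b.orthonormal.comp τ hτ).orthogonalFamily.linearIsometry).comp
      b.repr.toLinearIsometry, fun i => ?_⟩
    change (b.orthonormal.comp τ hτ).orthogonalFamily.linearIsometry (b.repr (b i)) = _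
    rw [HilbertBasis.repr_self]
    have hv := (b.orthonormal.comp τ hτ).orthogonalFamily
    exact (hv.linearIsometry_apply_single (i := i) (1 : ℂ)).trans
      (one_smul ℂ _)
  obtain ⟨S, hS⟩ := key (fun i => σ (Sum.inl i)) (σ.injective.comp Sum.inl_injective)
  obtain ⟨T, hT⟩ := key (fun i => σ (Sum.inr i)) (σ.injective.comp Sum.inr_injective)
  have h1 : ∀ V : L →ₗᵢ[ℂ] L, star V.toContinuousLinearMap * V.toContinuousLinearMap = 1 :=
    fun V => by
      rw [star_eq_adjoint]
      exact (norm_map_iff_adjoint_comp_self _).mp fun x => V.norm_map x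
  refine ⟨S.toContinuousLinearMap, T.toContinuousLinearMap, h1 S, h1 T, ?_⟩
  refine ContinuousLinearMap.ext_on
    (Submodule.dense_iff_topologicalClosure_eq_top.mpr b.dense_span) ?_
  rintro _ ⟨j, rfl⟩
  have h0 : ∀ y : L, (∀ i, inner ℂ (b i) y = 0) → y = 0 := fun y hy =>
    (b.hasSum_repr y).unique (by simp [b.repr_apply_apply, hy, hasSum_zero])
  refine h0 _ fun i => ?_
  rw [mul_apply_eq_comp, star_eq_adjoint, adjoint_inner_right]
  change inner ℂ (S (b i)) (T (b j)) = 0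
  rw [hS, hT, b.orthonormal.inner_eq_zero]
  simp

end Isometries

/-! ### The outer multiplications and the strong amplification -/

section Bimodule

variable {L : Type*} [NormedAddCommGroup L] [InnerProductSpace ℂ L]
variable {E : Type*} [AddCommGroup E] [Module ℂ E]
variable {F : Type*} [AddCommGroup F] [Module ℂ F]
variable {G : Type*} [AddCommGroup G] [Module ℂ G]

theorem lmul_tmul (a : L →L[ℂ] L) (b : Cpt L) (x : E) :
    lmul a (b ⊗ₜ[ℂ] x) = cptMulLeft a b ⊗ₜ[ℂ] x := rfl

theorem rmul_tmul (a : L →L[ℂ] L) (b : Cpt L) (x : E) :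
    rmul a (b ⊗ₜ[ℂ] x) = cptMulRight a b ⊗ₜ[ℂ] x := rfl

theorem lmul_lmul (a b : L →L[ℂ] L) (u : Amp L E) : lmul a (lmul b u) = lmul (a * b) u := by
  induction u using TensorProduct.induction_on with
  | zero => simp
  | add u v hu hv => simp only [map_add, hu, hv]
  | tmul c x =>
    exact congrArg (· ⊗ₜ[ℂ] x) (Subtype.ext (mul_assoc a b c.1).symm)

theorem rmul_rmul (a b : L →L[ℂ] L) (u : Amp L E) : rmul a (rmul b u) = rmul (b * a) u := by
  induction u using TensorProduct.induction_on with
  | zero => simp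
  | add u v hu hv => simp only [map_add, hu, hv]
  | tmul c x =>
    exact congrArg (· ⊗ₜ[ℂ] x) (Subtype.ext (mul_assoc c.1 b a))

theorem lmul_rmul (a b : L →L[ℂ] L) (u : Amp L E) : lmul a (rmul b u) = rmul b (lmul a u) := by
  induction u using TensorProduct.induction_on with
  | zero => simp
  | add u v hu hv => simp only [map_add, hu, hv]
  | tmul c x =>
    exact congrArg (· ⊗ₜ[ℂ] x) (Subtype.ext (mul_assoc a c.1 b).symm)

theorem lmul_smul_one (r : ℂ) (u : Amp L E) : lmul (r • (1 : L →L[ℂ] L)) u = r • u := by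
  induction u using TensorProduct.induction_on with
  | zero => simp
  | add u v hu hv => simp only [map_add, hu, hv, smul_add]
  | tmul c x =>
    rw [lmul_tmul, TensorProduct.smul_tmul']
    exact congrArg (· ⊗ₜ[ℂ] x) (Subtype.ext (by simp [cptMulLeft]))

theorem rmul_smul_one (r : ℂ) (u : Amp L E) : rmul (r • (1 : L →L[ℂ] L)) u = r • u := by
  induction u using TensorProduct.induction_on with
  | zero => simp
  | add u v hu hv => simp only [map_add, hu, hv, smul_add]
  | tmul c x =>
    rw [rmul_tmul, TensorProduct.smul_tmul']
    exact congrArg (· ⊗ₜ[ℂ] x) (Subtype.ext (by simp [cptMulRight]))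

theorem lmul_one (u : Amp L E) : lmul (1 : L →L[ℂ] L) u = u := by
  simpa using lmul_smul_one 1 u

theorem lmul_zero (u : Amp L E) : lmul (0 : L →L[ℂ] L) u = 0 := by
  simpa using lmul_smul_one 0 u

variable (R : E →ₗ[ℂ] F →ₗ[ℂ] G)

theorem strongAmp_lmul (a : L →L[ℂ] L) (u : Amp L E) (v : Amp L F) :
    strongAmp L R (lmul a u) v = lmul a (strongAmp L R u v) := by
  induction u using TensorProduct.induction_on with
  | zero => simp
  | add u u' hu hu' => simp only [map_add, LinearMap.add_apply, hu, hu']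
  | tmul b x =>
    induction v using TensorProduct.induction_on with
    | zero => simp
    | add v v' hv hv' => simp only [map_add, hv, hv']
    | tmul c y =>
      simp only [lmul_tmul, strongAmp_tmul]
      exact congrArg (· ⊗ₜ[ℂ] R x y) (Subtype.ext (mul_assoc a b.1 c.1))

theorem strongAmp_rmul (a : L →L[ℂ] L) (u : Amp L E) (v : Amp L F) :
    strongAmp L R u (rmul a v) = rmul a (strongAmp L R u v) := by
  induction u using TensorProduct.induction_on with
  | zero => simp
  | add u u' hu hu' => simp only [map_add, LinearMap.add_apply, hu, hu']
  | tmul b x =>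
    induction v using TensorProduct.induction_on with
    | zero => simp
    | add v v' hv hv' => simp only [map_add, hv, hv']
    | tmul c y =>
      simp only [rmul_tmul, strongAmp_tmul]
      exact congrArg (· ⊗ₜ[ℂ] R x y) (Subtype.ext (mul_assoc b.1 c.1 a).symm)

/-- The strong amplification is balanced over the bounded operators. -/
theorem strongAmp_rmul_left (a : L →L[ℂ] L) (u : Amp L E) (v : Amp L F) :
    strongAmp L R (rmul a u) v = strongAmp L R u (lmul a v) := by
  induction u using TensorProduct.induction_on with
  | zero => simp
  | add u u' hu hu' => simp only [map_add, LinearMap.add_apply, hu, hu']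
  | tmul b x =>
    induction v using TensorProduct.induction_on with
    | zero => simp
    | add v v' hv hv' => simp only [map_add, hv, hv']
    | tmul c y =>
      simp only [lmul_tmul, rmul_tmul, strongAmp_tmul]
      exact congrArg (· ⊗ₜ[ℂ] R x y) (Subtype.ext (mul_assoc b.1 a c.1))

end Bimodule

/-! ### Rows and columns -/

section RowColumn

variable {L : Type*} [NormedAddCommGroup L] [InnerProductSpace ℂ L] [CompleteSpace L]
variable {E : Type*} [AddCommGroup E] [Module ℂ E]
variable {F : Type*} [AddCommGroup F] [Module ℂ F]
variable {G : Type*} [AddCommGroup G] [Module ℂ G]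

/-- `S` and `T` are isometries of `L` with orthogonal ranges. -/
structure OrthIsometries (S T : L →L[ℂ] L) : Prop where
  left : star S * S = 1
  right : star T * T = 1
  orth : star S * T = 0

namespace OrthIsometries

variable {S T : L →L[ℂ] L} (h : OrthIsometries S T)
include h

theorem orth' : star T * S = 0 := by
  simpa using congrArg star h.orth

theorem norm_left_le : ‖S‖ ≤ 1 := by
  have h1 := CStarRing.norm_star_mul_self (x := S)
  rw [h.left] at h1
  have h2 : ‖(1 : L →L[ℂ] L)‖ ≤ 1 := ContinuousLinearMap.norm_id_le
  nlinarith [norm_nonneg S]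

theorem norm_right_le : ‖T‖ ≤ 1 := by
  have h1 := CStarRing.norm_star_mul_self (x := T)
  rw [h.right] at h1
  have h2 : ‖(1 : L →L[ℂ] L)‖ ≤ 1 := ContinuousLinearMap.norm_id_le
  nlinarith [norm_nonneg T]

theorem isStarProjection_left : IsStarProjection (S * star S) where
  isIdempotentElem := by
    rw [IsIdempotentElem, mul_assoc, ← mul_assoc (star S), h.left, one_mul]
  isSelfAdjoint := IsSelfAdjoint.mul_star_self S

theorem isStarProjection_right : IsStarProjection (T * star T) where
  isIdempotentElem := by
    rw [IsIdempotentElem, mul_assoc, ← mul_assoc (star T), h.right, one_mul]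
  isSelfAdjoint := IsSelfAdjoint.mul_star_self T

/-- Placing `u` and `v` on the diagonal, at the orthogonal ranges of `S` and `T`. -/
theorem diag_le {N : Amp L E → ℝ} (hN : IsQuantumNorm N) (u v : Amp L E) :
    N (lmul S (rmul (star S) u) + lmul T (rmul (star T) v)) ≤ max (N u) (N v) := by
  rw [hN.ruanII _ _ (S * star S) (T * star T) ⟨h.isStarProjection_left, ?_, ?_⟩
    ⟨h.isStarProjection_right, ?_, ?_⟩ ?_]
  · have key : ∀ (V : L →L[ℂ] L) (w : Amp L E), ‖V‖ ≤ 1 →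
        N (lmul V (rmul (star V) w)) ≤ N w := fun V w hV => by
      have h1 := (hN.ruanI V (rmul (star V) w)).1
      have h2 := (hN.ruanI (star V) w).2
      rw [norm_star] at h2
      have h3 := hN.nonneg w
      have h4 := hN.nonneg (rmul (star V) w)
      nlinarith [norm_nonneg V]
    exact max_le_max (key S u h.norm_left_le) (key T v h.norm_right_le)
  · rw [lmul_lmul, mul_assoc, h.left, mul_one]
  · rw [lmul_rmul, rmul_rmul, ← mul_assoc, h.left, one_mul]
  · rw [lmul_lmul, mul_assoc, h.right, mul_one]
  · rw [lmul_rmul, rmul_rmul, ← mul_assoc, h.right, one_mul]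
  · rw [mul_assoc, ← mul_assoc (star S), h.orth, zero_mul, mul_zero]

/-- The row with entries `a · u`, `b · v` is the diagonal of `u`, `v` multiplied from the left by
`W = a S⋆ + b T⋆`, and `W W⋆ = a a⋆ + b b⋆`. -/
theorem row_le {N : Amp L E → ℝ} (hN : IsQuantumNorm N) (a b : L →L[ℂ] L) (u v : Amp L E) :
    N (lmul a (rmul (star S) u) + lmul b (rmul (star T) v)) ≤
      √‖a * star a + b * star b‖ * max (N u) (N v) := by
  set W : L →L[ℂ] L := a * star S + b * star T with hW
  have hSW : W * S = a := by rw [hW, add_mul, mul_assoc, mul_assoc, h.left, h.orth']; simp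
  have hTW : W * T = b := by rw [hW, add_mul, mul_assoc, mul_assoc, h.right, h.orth]; simp
  have hWW : W * star W = a * star a + b * star b := by
    conv_lhs => rw [hW, star_add, star_mul, star_mul, star_star, star_star, ← hW]
    rw [mul_add, ← mul_assoc, ← mul_assoc, hSW, hTW]
  have hnorm : ‖W‖ = √‖a * star a + b * star b‖ := by
    rw [← hWW, CStarRing.norm_self_mul_star, Real.sqrt_mul_self (norm_nonneg _)]
  have := (hN.ruanI W (lmul S (rmul (star S) u) + lmul T (rmul (star T) v))).1
  rw [map_add, lmul_lmul, lmul_lmul, hSW, hTW, hnorm] at this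
  exact this.trans (mul_le_mul_of_nonneg_left (h.diag_le hN u v) (Real.sqrt_nonneg _))

/-- The column with entries `u · a`, `v · b`; see `OrthIsometries.row_le`. -/
theorem column_le {N : Amp L E → ℝ} (hN : IsQuantumNorm N) (a b : L →L[ℂ] L) (u v : Amp L E) :
    N (rmul a (lmul S u) + rmul b (lmul T v)) ≤
      √‖star a * a + star b * b‖ * max (N u) (N v) := by
  set W : L →L[ℂ] L := S * a + T * b with hW
  have hSW : star S * W = a := by
    rw [hW, mul_add, ← mul_assoc, ← mul_assoc, h.left, h.orth]; simp
  have hTW : star T * W = b := by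
    rw [hW, mul_add, ← mul_assoc, ← mul_assoc, h.right, h.orth']; simp
  have hWW : star W * W = star a * a + star b * b := by
    conv_lhs => rw [hW, star_add, star_mul, star_mul, ← hW]
    rw [add_mul, mul_assoc, mul_assoc, hSW, hTW]
  have hnorm : ‖W‖ = √‖star a * a + star b * b‖ := by
    rw [← hWW, CStarRing.norm_star_mul_self, Real.sqrt_mul_self (norm_nonneg _)]
  have := (hN.ruanI W (lmul S (rmul (star S) u) + lmul T (rmul (star T) v))).2
  rw [map_add, lmul_rmul, lmul_rmul, rmul_rmul, rmul_rmul, hSW, hTW, hnorm] at this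
  refine this.trans (mul_le_mul_of_nonneg_left ?_ (Real.sqrt_nonneg _))
  rw [← lmul_rmul, ← lmul_rmul]
  exact h.diag_le hN u v

/-- A row times a column is the sum of the products of the entries. -/
theorem strongAmp_row_column (R : E →ₗ[ℂ] F →ₗ[ℂ] G) (u u' : Amp L E) (v v' : Amp L F) :
    strongAmp L R (rmul (star S) u + rmul (star T) u') (lmul S v + lmul T v') =
      strongAmp L R u v + strongAmp L R u' v' := by
  simp only [map_add, LinearMap.add_apply, strongAmp_rmul_left, lmul_lmul, h.left, h.right,
    h.orth, h.orth', lmul_one, lmul_zero, map_zero]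
  abel

end OrthIsometries

end RowColumn

/-! ### Single-pair representations and the axioms of Ruan -/

section HaagerupNorm

variable {L : Type*} [NormedAddCommGroup L] [InnerProductSpace ℂ L] [CompleteSpace L]
variable {E : Type*} [AddCommGroup E] [Module ℂ E]
variable {F : Type*} [AddCommGroup F] [Module ℂ F]
variable {G : Type*} [AddCommGroup G] [Module ℂ G]

namespace IsQuantumNorm

variable {N : Amp L E → ℝ} (hN : IsQuantumNorm N)
include hN

theorem map_zero : N 0 = 0 := by
  simpa using hN.smul 0 0

theorem pos {u : Amp L E} (hu : u ≠ 0) : 0 < N u :=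
  (hN.nonneg u).lt_of_ne fun h => hu (hN.eq_zero u h.symm)

theorem normalize_le (u : Amp L E) : N (((N u)⁻¹ : ℂ) • u) ≤ 1 := by
  rw [hN.smul, norm_inv, Complex.norm_of_nonneg (hN.nonneg u)]
  exact inv_mul_le_one

theorem smul_normalize (u : Amp L E) : (N u : ℂ) • ((N u)⁻¹ : ℂ) • u = u := by
  by_cases hu : u = 0
  · simp [hu]
  · rw [smul_smul, mul_inv_cancel₀ (by exact_mod_cast (hN.pos hu).ne'), one_smul]

end IsQuantumNorm

theorem norm_smul_one_sq_add_le (p q : ℝ) :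
    ‖((p : ℂ) • (1 : L →L[ℂ] L)) * star ((p : ℂ) • 1) +
      ((q : ℂ) • (1 : L →L[ℂ] L)) * star ((q : ℂ) • 1)‖ ≤ p ^ 2 + q ^ 2 := by
  have h1 : ‖(1 : L →L[ℂ] L)‖ ≤ 1 := ContinuousLinearMap.norm_id_le
  have : ((p : ℂ) • (1 : L →L[ℂ] L)) * star ((p : ℂ) • 1) +
      ((q : ℂ) • (1 : L →L[ℂ] L)) * star ((q : ℂ) • 1) = ((p : ℂ) ^ 2 + (q : ℂ) ^ 2) • 1 := by
    simp only [star_smul, star_one, Complex.star_def, Complex.conj_ofReal, smul_mul_smul_comm,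
      mul_one, ← add_smul, sq]
  have hpq : (p : ℂ) ^ 2 + (q : ℂ) ^ 2 = ((p ^ 2 + q ^ 2 : ℝ) : ℂ) := by push_cast; rfl
  rw [this, hpq, norm_smul, Complex.norm_of_nonneg (by positivity)]
  exact mul_le_of_le_one_right (by positivity) h1

namespace OrthIsometries

variable {S T : L →L[ℂ] L} (h : OrthIsometries S T)
include h

/-- Normalize the entries and use `OrthIsometries.row_le` with the scalars `N u` and `N v`. -/
theorem row_le_sqrt {N : Amp L E → ℝ} (hN : IsQuantumNorm N) (u v : Amp L E) :
    N (rmul (star S) u + rmul (star T) v) ≤ √(N u ^ 2 + N v ^ 2) := by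
  have := h.row_le hN ((N u : ℂ) • 1) ((N v : ℂ) • 1) (((N u)⁻¹ : ℂ) • u) (((N v)⁻¹ : ℂ) • v)
  rw [lmul_smul_one, lmul_smul_one, ← map_smul, ← map_smul, hN.smul_normalize,
    hN.smul_normalize] at this
  refine this.trans (mul_le_of_le_one_right (Real.sqrt_nonneg _)
    (max_le (hN.normalize_le u) (hN.normalize_le v)) |>.trans (Real.sqrt_le_sqrt ?_))
  exact norm_smul_one_sq_add_le _ _

theorem column_le_sqrt {N : Amp L E → ℝ} (hN : IsQuantumNorm N) (u v : Amp L E) :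
    N (lmul S u + lmul T v) ≤ √(N u ^ 2 + N v ^ 2) := by
  have := h.column_le hN ((N u : ℂ) • 1) ((N v : ℂ) • 1) (((N u)⁻¹ : ℂ) • u) (((N v)⁻¹ : ℂ) • v)
  rw [rmul_smul_one, rmul_smul_one, ← map_smul, ← map_smul, hN.smul_normalize,
    hN.smul_normalize] at this
  refine this.trans (mul_le_of_le_one_right (Real.sqrt_nonneg _)
    (max_le (hN.normalize_le u) (hN.normalize_le v)) |>.trans (Real.sqrt_le_sqrt ?_))
  convert norm_smul_one_sq_add_le (L := L) (N u) (N v) using 3 <;> simp [star_smul]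

end OrthIsometries

variable {nE : Amp L E → ℝ} {nF : Amp L F → ℝ}

/-- The two factors of `u ⊙ v` can be rescaled to have the same norm. -/
theorem exists_balanced (hE : IsQuantumNorm nE) (hF : IsQuantumNorm nF)
    (R : E →ₗ[ℂ] F →ₗ[ℂ] G) (u : Amp L E) (v : Amp L F) :
    ∃ x y, strongAmp L R x y = strongAmp L R u v ∧
      nE x ≤ √(nE u * nF v) ∧ nF y ≤ √(nE u * nF v) := by
  by_cases hu : u = 0
  · exact ⟨0, 0, by simp [hu], by simp [hE.map_zero], by simp [hF.map_zero]⟩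
  by_cases hv : v = 0
  · exact ⟨0, 0, by simp [hv], by simp [hE.map_zero], by simp [hF.map_zero]⟩
  have h1 := hE.pos hu
  have h2 := hF.pos hv
  set p := √(nE u * nF v) with hp
  have hp0 : 0 ≤ p := Real.sqrt_nonneg _
  have hpp : p * p = nE u * nF v := Real.mul_self_sqrt (by positivity)
  refine ⟨((p / nE u : ℝ) : ℂ) • u, ((p / nF v : ℝ) : ℂ) • v, ?_, ?_, ?_⟩
  · rw [map_smul, map_smul, LinearMap.smul_apply, smul_smul, ← Complex.ofReal_mul]
    have : p / nF v * (p / nE u) = 1 := by field_simp; linarith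
    rw [this, Complex.ofReal_one, one_smul]
  · rw [hE.smul, Complex.norm_of_nonneg (by positivity), div_mul_cancel₀ _ h1.ne']
  · rw [hF.smul, Complex.norm_of_nonneg (by positivity), div_mul_cancel₀ _ h2.ne']

/-- Two summands `u ⊙ v` merge into one, without increasing the sum of the products of norms: a row
and a column are formed from the balanced factors. -/
theorem exists_strongAmp_add (hL : ¬ FiniteDimensional ℂ L) (hE : IsQuantumNorm nE)
    (hF : IsQuantumNorm nF) (R : E →ₗ[ℂ] F →ₗ[ℂ] G) (u u' : Amp L E) (v v' : Amp L F) :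
    ∃ x y, strongAmp L R x y = strongAmp L R u v + strongAmp L R u' v' ∧
      nE x * nF y ≤ nE u * nF v + nE u' * nF v' := by
  obtain ⟨S, T, hS, hT, hST⟩ := exists_isometries hL
  have h : OrthIsometries S T := ⟨hS, hT, hST⟩
  obtain ⟨x, y, hxy, hx, hy⟩ := exists_balanced hE hF R u v
  obtain ⟨x', y', hxy', hx', hy'⟩ := exists_balanced hE hF R u' v'
  have h0 : 0 ≤ nE u * nF v := mul_nonneg (hE.nonneg u) (hF.nonneg v)
  have h0' : 0 ≤ nE u' * nF v' := mul_nonneg (hE.nonneg u') (hF.nonneg v')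
  refine ⟨_, _, (h.strongAmp_row_column R x x' y y').trans (by rw [hxy, hxy']), ?_⟩
  rw [Real.le_sqrt (hE.nonneg _) h0] at hx
  rw [Real.le_sqrt (hE.nonneg _) h0'] at hx'
  rw [Real.le_sqrt (hF.nonneg _) h0] at hy
  rw [Real.le_sqrt (hF.nonneg _) h0'] at hy'
  rw [← Real.mul_self_sqrt (add_nonneg h0 h0')]
  exact mul_le_mul
    ((h.row_le_sqrt hE x x').trans (Real.sqrt_le_sqrt (add_le_add hx hx')))
    ((h.column_le_sqrt hF y y').trans (Real.sqrt_le_sqrt (add_le_add hy hy')))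
    (hF.nonneg _) (Real.sqrt_nonneg _)

theorem exists_strongAmp_sum (hL : ¬ FiniteDimensional ℂ L) (hE : IsQuantumNorm nE)
    (hF : IsQuantumNorm nF) (R : E →ₗ[ℂ] F →ₗ[ℂ] G) (n : ℕ) (u : Fin n → Amp L E)
    (v : Fin n → Amp L F) :
    ∃ x y, strongAmp L R x y = ∑ k, strongAmp L R (u k) (v k) ∧
      nE x * nF y ≤ ∑ k, nE (u k) * nF (v k) := by
  induction n with
  | zero => exact ⟨0, 0, by simp, by simp [hE.map_zero]⟩
  | succ n ih =>
    obtain ⟨x, y, hxy, hle⟩ := ih (fun k => u k.castSucc) (fun k => v k.castSucc)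
    obtain ⟨x', y', hxy', hle'⟩ :=
      exists_strongAmp_add hL hE hF R x (u (Fin.last n)) y (v (Fin.last n))
    refine ⟨x', y', ?_, ?_⟩
    · rw [hxy', hxy, Fin.sum_univ_castSucc]
    · rw [Fin.sum_univ_castSucc]; linarith

section ProjNorm

variable {X Y : Type*} [AddCommGroup X] [Module ℂ X] [AddCommGroup Y] [Module ℂ Y]
variable {nX : X → ℝ} {nY : Y → ℝ}

theorem projNorm_set_nonneg (hX : ∀ x, 0 ≤ nX x) (hY : ∀ y, 0 ≤ nY y) (t : X ⊗[ℂ] Y) (r : ℝ)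
    (hr : r ∈ {r | ∃ (n : ℕ) (x : Fin n → X) (y : Fin n → Y),
      t = ∑ k, x k ⊗ₜ[ℂ] y k ∧ r = ∑ k, nX (x k) * nY (y k)}) : 0 ≤ r := by
  obtain ⟨n, x, y, -, rfl⟩ := hr
  exact Finset.sum_nonneg fun k _ => mul_nonneg (hX _) (hY _)

theorem projNorm_nonneg (hX : ∀ x, 0 ≤ nX x) (hY : ∀ y, 0 ≤ nY y) (t : X ⊗[ℂ] Y) :
    0 ≤ projNorm nX nY t :=
  Real.sInf_nonneg (projNorm_set_nonneg hX hY t)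

theorem projNorm_tmul_le (hX : ∀ x, 0 ≤ nX x) (hY : ∀ y, 0 ≤ nY y) (x : X) (y : Y) :
    projNorm nX nY (x ⊗ₜ y) ≤ nX x * nY y :=
  csInf_le ⟨0, fun r hr => projNorm_set_nonneg hX hY _ r hr⟩
    ⟨1, fun _ => x, fun _ => y, by simp, by simp⟩

theorem exists_of_projNorm_lt {t : X ⊗[ℂ] Y} {r : ℝ} (h : projNorm nX nY t < r) :
    ∃ (n : ℕ) (x : Fin n → X) (y : Fin n → Y),
      t = ∑ k, x k ⊗ₜ[ℂ] y k ∧ ∑ k, nX (x k) * nY (y k) < r := by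
  obtain ⟨_, ⟨n, x, y, ht, rfl⟩, hlt⟩ := exists_lt_of_csInf_lt (by
    obtain ⟨n, x, y, h⟩ := TensorProduct.exists_sum_tmul_eq t
    exact ⟨_, n, x, y, h, rfl⟩) h
  exact ⟨n, x, y, ht, hlt⟩

end ProjNorm

/-- A shortcut: without it, instance search first explores the normed structures on operators. -/
instance : AddCommGroup (Amp L E) := TensorProduct.addCommGroup

theorem haagerup_nonneg (hE : IsQuantumNorm nE) (hF : IsQuantumNorm nF)
    (U : Amp L (E ⊗[ℂ] F)) : 0 ≤ haagerup nE nF U := by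
  apply Real.sInf_nonneg
  rintro _ ⟨t, -, rfl⟩
  exact projNorm_nonneg hE.nonneg hF.nonneg t

theorem haagerup_strongAmp_le (hE : IsQuantumNorm nE) (hF : IsQuantumNorm nF)
    (u : Amp L E) (v : Amp L F) :
    haagerup nE nF (strongAmp L (TensorProduct.mk ℂ E F) u v) ≤ nE u * nF v := by
  have hb : BddBelow (projNorm nE nF '' {t | effros L E F t =
      strongAmp L (TensorProduct.mk ℂ E F) u v}) := by
    refine ⟨0, ?_⟩
    rintro _ ⟨t, -, rfl⟩
    exact projNorm_nonneg hE.nonneg hF.nonneg t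
  exact (csInf_le hb ⟨u ⊗ₜ v, effros_tmul u v, rfl⟩).trans
    (projNorm_tmul_le hE.nonneg hF.nonneg u v)

/-- Below any bound exceeding the Haagerup seminorm of `U` there is a representation of `U` by a
single pair `u ⊙ v`, with both factors of norm at most the square root of the bound. -/
theorem exists_of_haagerup_lt (hL : ¬ FiniteDimensional ℂ L) (hE : IsQuantumNorm nE)
    (hF : IsQuantumNorm nF) {U : Amp L (E ⊗[ℂ] F)} {r : ℝ} (h : haagerup nE nF U < r) :
    ∃ u v, strongAmp L (TensorProduct.mk ℂ E F) u v = U ∧ nE u ≤ √r ∧ nF v ≤ √r := by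
  obtain ⟨_, ⟨t, rfl, rfl⟩, ht⟩ := exists_lt_of_csInf_lt (by
    obtain ⟨t, ht⟩ := effros_surjective E F U
    exact ⟨_, t, ht, rfl⟩) h
  obtain ⟨n, x, y, rfl, hlt⟩ := exists_of_projNorm_lt ht
  obtain ⟨u, v, huv, hle⟩ := exists_strongAmp_sum hL hE hF (TensorProduct.mk ℂ E F) n x y
  obtain ⟨u', v', huv', h1, h2⟩ := exists_balanced hE hF (TensorProduct.mk ℂ E F) u v
  have hr := Real.sqrt_le_sqrt (hle.trans hlt.le)
  exact ⟨u', v', by rw [huv', huv, map_sum]; simp only [effros_tmul], h1.trans hr, h2.trans hr⟩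

theorem haagerup_add_le (hL : ¬ FiniteDimensional ℂ L) (hE : IsQuantumNorm nE)
    (hF : IsQuantumNorm nF) (U V : Amp L (E ⊗[ℂ] F)) :
    haagerup nE nF (U + V) ≤ haagerup nE nF U + haagerup nE nF V := by
  refine le_of_forall_pos_le_add fun ε hε => ?_
  have h1 := haagerup_nonneg hE hF U
  have h2 := haagerup_nonneg hE hF V
  obtain ⟨u, v, rfl, hu, hv⟩ := exists_of_haagerup_lt hL hE hF
    (show haagerup nE nF U < haagerup nE nF U + ε / 2 by linarith)
  obtain ⟨u', v', rfl, hu', hv'⟩ := exists_of_haagerup_lt hL hE hF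
    (show haagerup nE nF V < haagerup nE nF V + ε / 2 by linarith)
  obtain ⟨x, y, hxy, hle⟩ := exists_strongAmp_add hL hE hF (TensorProduct.mk ℂ E F) u u' v v'
  have a1 := mul_le_mul hu hv (hF.nonneg _) (Real.sqrt_nonneg _)
  have a2 := mul_le_mul hu' hv' (hF.nonneg _) (Real.sqrt_nonneg _)
  rw [Real.mul_self_sqrt (by linarith)] at a1 a2
  have a3 := haagerup_strongAmp_le hE hF x y
  rw [hxy] at a3
  linarith

/-- The Haagerup seminorm of `U` is the infimum of `‖u‖ ‖v‖` over the representations `U = u ⊙ v`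
by a single pair, in the form of a criterion for lower bounds. -/
theorem le_mul_haagerup (hL : ¬ FiniteDimensional ℂ L) (hE : IsQuantumNorm nE)
    (hF : IsQuantumNorm nF) {U : Amp L (E ⊗[ℂ] F)} {c r : ℝ} (hc : 0 ≤ c)
    (h : ∀ u v, strongAmp L (TensorProduct.mk ℂ E F) u v = U → r ≤ c * (nE u * nF v)) :
    r ≤ c * haagerup nE nF U := by
  have h0 := haagerup_nonneg hE hF U
  refine le_of_forall_pos_le_add fun ε hε => ?_
  have hd : 0 < ε / (c + 1) := by positivity
  obtain ⟨u, v, hU, hu, hv⟩ := exists_of_haagerup_lt hL hE hF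
    (show haagerup nE nF U < haagerup nE nF U + ε / (c + 1) by linarith)
  have a1 := mul_le_mul hu hv (hF.nonneg _) (Real.sqrt_nonneg _)
  rw [Real.mul_self_sqrt (by linarith)] at a1
  refine (h u v hU).trans ((mul_le_mul_of_nonneg_left a1 hc).trans ?_)
  rw [mul_add]
  have : c * (ε / (c + 1)) ≤ ε := by
    rw [← mul_div_assoc, div_le_iff₀ (by positivity)]; nlinarith
  linarith

theorem haagerup_smul_le (hL : ¬ FiniteDimensional ℂ L) (hE : IsQuantumNorm nE)
    (hF : IsQuantumNorm nF) (c : ℂ) (U : Amp L (E ⊗[ℂ] F)) :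
    haagerup nE nF (c • U) ≤ ‖c‖ * haagerup nE nF U := by
  refine le_mul_haagerup hL hE hF (norm_nonneg c) ?_
  rintro u v rfl
  rw [← LinearMap.smul_apply, ← map_smul, ← mul_assoc, ← hE.smul]
  exact haagerup_strongAmp_le hE hF _ _

theorem haagerup_smul (hL : ¬ FiniteDimensional ℂ L) (hE : IsQuantumNorm nE)
    (hF : IsQuantumNorm nF) (c : ℂ) (U : Amp L (E ⊗[ℂ] F)) :
    haagerup nE nF (c • U) = ‖c‖ * haagerup nE nF U := by
  refine (haagerup_smul_le hL hE hF c U).antisymm ?_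
  by_cases hc : c = 0
  · simpa [hc] using haagerup_nonneg hE hF _
  have := haagerup_smul_le hL hE hF c⁻¹ (c • U)
  rw [smul_smul, inv_mul_cancel₀ hc, one_smul, norm_inv] at this
  rwa [inv_mul_eq_div, le_div_iff₀' (norm_pos_iff.mpr hc)] at this

theorem haagerup_ruanI (hL : ¬ FiniteDimensional ℂ L) (hE : IsQuantumNorm nE)
    (hF : IsQuantumNorm nF) : RuanI (haagerup nE nF) := by
  refine fun a U => ⟨le_mul_haagerup hL hE hF (norm_nonneg a) ?_,
    le_mul_haagerup hL hE hF (norm_nonneg a) ?_⟩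
  · rintro u v rfl
    rw [← strongAmp_lmul, ← mul_assoc]
    exact (haagerup_strongAmp_le hE hF _ _).trans
      (mul_le_mul_of_nonneg_right (hE.ruanI a u).1 (hF.nonneg v))
  · rintro u v rfl
    rw [← strongAmp_rmul, mul_left_comm]
    exact (haagerup_strongAmp_le hE hF _ _).trans
      (mul_le_mul_of_nonneg_left (hF.ruanI a v).2 (hE.nonneg u))

theorem haagerup_ruanII (hL : ¬ FiniteDimensional ℂ L) (hE : IsQuantumNorm nE)
    (hF : IsQuantumNorm nF) : RuanII (haagerup nE nF) := by
  rintro U V P Q ⟨hP, hPU, hUP⟩ ⟨hQ, hQV, hVQ⟩ hPQ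
  have hQP : Q * P = 0 := by
    simpa [hP.isSelfAdjoint.star_eq, hQ.isSelfAdjoint.star_eq] using congrArg star hPQ
  apply le_antisymm
  · refine le_of_forall_gt_imp_ge_of_dense fun r hr => ?_
    have hr0 : 0 ≤ r := (haagerup_nonneg hE hF U).trans ((le_max_left _ _).trans hr.le)
    obtain ⟨u, v, hU, hu, hv⟩ := exists_of_haagerup_lt hL hE hF ((le_max_left _ _).trans_lt hr)
    obtain ⟨u', v', hV, hu', hv'⟩ := exists_of_haagerup_lt hL hE hF ((le_max_right _ _).trans_lt hr)
    obtain ⟨S, T, hS, hT, hST⟩ := exists_isometries hL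
    have h : OrthIsometries S T := ⟨hS, hT, hST⟩
    -- the row and column of the compressed factors have the norm of a diagonal, since `P + Q` is
    -- a projection
    have hsum : strongAmp L (TensorProduct.mk ℂ E F)
        (lmul P (rmul (star S) u) + lmul Q (rmul (star T) u'))
        (rmul P (lmul S v) + rmul Q (lmul T v')) = U + V := by
      rw [lmul_rmul P, lmul_rmul Q, ← lmul_rmul S, ← lmul_rmul T, h.strongAmp_row_column, strongAmp_lmul, strongAmp_lmul, strongAmp_rmul, strongAmp_rmul,
        hU, hV, hUP, hVQ, hPU, hQV]
    have hnorm : √‖P * star P + Q * star Q‖ ≤ 1 := by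
      rw [hP.isSelfAdjoint.star_eq, hQ.isSelfAdjoint.star_eq, hP.isIdempotentElem.eq,
        hQ.isIdempotentElem.eq, Real.sqrt_le_one]
      exact IsStarProjection.norm_le _ (hP.add hQ hPQ)
    have hnorm' : √‖star P * P + star Q * Q‖ ≤ 1 := by
      rw [hP.isSelfAdjoint.star_eq, hQ.isSelfAdjoint.star_eq] at hnorm ⊢
      exact hnorm
    have hrow := (h.row_le hE P Q u u').trans
      (mul_le_of_le_one_left (le_max_of_le_left (hE.nonneg _)) hnorm) |>.trans (max_le hu hu')
    have hcol := (h.column_le hF P Q v v').trans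
      (mul_le_of_le_one_left (le_max_of_le_left (hF.nonneg _)) hnorm') |>.trans (max_le hv hv')
    rw [← hsum]
    refine (haagerup_strongAmp_le hE hF _ _).trans ?_
    rw [← Real.mul_self_sqrt hr0]
    exact mul_le_mul hrow hcol (hF.nonneg _) (Real.sqrt_nonneg _)
  · have key : ∀ (P : L →L[ℂ] L) (W W' : Amp L (E ⊗[ℂ] F)), IsStarProjection P →
        lmul P W = W' → haagerup nE nF W' ≤ haagerup nE nF W := by
      rintro P W _ hP rfl
      exact (haagerup_ruanI hL hE hF P W).1.trans
        (mul_le_of_le_one_left (haagerup_nonneg hE hF W) (IsStarProjection.norm_le _ hP))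
    refine max_le (key P _ _ hP ?_) (key Q _ _ hQ ?_)
    · rw [map_add, hPU, ← hQV, lmul_lmul, hPQ, lmul_zero, add_zero]
    · rw [map_add, hQV, ← hPU, lmul_lmul, hQP, lmul_zero, zero_add]

end HaagerupNorm

/-! ### Slices by functionals -/

section Slice

/-- The slice map `X ⊗ V → X`, `c ⊗ x ↦ f x • c`, of a functional `f` on `V`. -/
noncomputable def slice (X : Type*) [AddCommGroup X] [Module ℂ X] {V : Type*} [AddCommGroup V]
    [Module ℂ V] (f : V →ₗ[ℂ] ℂ) : X ⊗[ℂ] V →ₗ[ℂ] X :=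
  (TensorProduct.rid ℂ X).toLinearMap ∘ₗ LinearMap.lTensor X f

variable {X : Type*} [AddCommGroup X] [Module ℂ X] {V : Type*} [AddCommGroup V] [Module ℂ V]
  {W : Type*} [AddCommGroup W] [Module ℂ W]

@[simp]
theorem slice_tmul (f : V →ₗ[ℂ] ℂ) (c : X) (x : V) : slice X f (c ⊗ₜ x) = f x • c := by
  simp [slice]

/-- The slice maps of a separating set of functionals separate the points of `X ⊗ V`. -/
theorem eq_zero_of_forall_slice {Φ : Set (V →ₗ[ℂ] ℂ)} (hΦ : ∀ x, (∀ f ∈ Φ, f x = 0) → x = 0)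
    (t : X ⊗[ℂ] V) (h : ∀ f ∈ Φ, slice X f t = 0) : t = 0 := by
  classical
  let B := Module.Basis.ofVectorSpace ℂ X
  have key : ∀ (f : V →ₗ[ℂ] ℂ) (t : X ⊗[ℂ] V) i,
      B.repr (slice X f t) i = f (TensorProduct.equivFinsuppOfBasisLeft B t i) := by
    intro f t i
    induction t using TensorProduct.induction_on with
    | zero => simp
    | add s t hs ht => simp only [map_add, Finsupp.add_apply, hs, ht]
    | tmul c x => simp [mul_comm]
  rw [← (TensorProduct.equivFinsuppOfBasisLeft B).map_eq_zero_iff]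
  ext i
  refine hΦ _ fun f hf => ?_
  rw [← key, h f hf]
  simp

/-- The functional `f ⊗ g` on `V ⊗ W`. -/
noncomputable def tensorFunctional (f : V →ₗ[ℂ] ℂ) (g : W →ₗ[ℂ] ℂ) : V ⊗[ℂ] W →ₗ[ℂ] ℂ :=
  f ∘ₗ slice V g

@[simp]
theorem tensorFunctional_tmul (f : V →ₗ[ℂ] ℂ) (g : W →ₗ[ℂ] ℂ) (x : V) (y : W) :
    tensorFunctional f g (x ⊗ₜ y) = g y * f x := by
  simp [tensorFunctional]

end Slice

/-! ### Definiteness of the Haagerup seminorm -/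

section Definite

variable {L : Type*} [NormedAddCommGroup L] [InnerProductSpace ℂ L]
variable {E : Type*} [AddCommGroup E] [Module ℂ E]
variable {F : Type*} [AddCommGroup F] [Module ℂ F]

/-- The rank-one operator `z ↦ ⟪y, z⟫ x` as a compact operator. -/
noncomputable def rankOneCpt (x y : L) : Cpt L :=
  ⟨InnerProductSpace.rankOne ℂ x y, by
    rw [InnerProductSpace.rankOne_def']
    exact IsCompactOperator.comp_clm (f := ContinuousLinearMap.toSpanSingleton ℂ x)
      (isCompactOperator_of_locallyCompactSpace_rng
        (ContinuousLinearMap.toSpanSingleton ℂ x)) (innerSL ℂ y)⟩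

/-- Compressing `u` by rank-one operators leaves `e e⋆ ⊗ x` for some `x : E`, and a functional `f`
takes at `x` the value of a matrix coefficient of the slice of `u` by `f`. -/
theorem exists_compression (e ζ ξ : L) (u : Amp L E) :
    ∃ x : E, lmul (InnerProductSpace.rankOne ℂ e ζ) (rmul (InnerProductSpace.rankOne ℂ ξ e) u) =
        rankOneCpt e e ⊗ₜ[ℂ] x ∧
      ∀ f : E →ₗ[ℂ] ℂ, inner ℂ ζ ((slice (Cpt L) f u).1 ξ) = f x := by
  induction u using TensorProduct.induction_on with
  | zero => exact ⟨0, by simp, by simp⟩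
  | add u v hu hv =>
    obtain ⟨x, hx, hfx⟩ := hu
    obtain ⟨y, hy, hfy⟩ := hv
    refine ⟨x + y, by simp only [map_add, hx, hy, TensorProduct.tmul_add], fun f => ?_⟩
    rw [map_add, map_add, ← hfx, ← hfy, ← inner_add_right]
    rfl
  | tmul c x =>
    refine ⟨inner ℂ ζ (c.1 ξ) • x, ?_, fun f => ?_⟩
    · rw [rmul_tmul, lmul_tmul, TensorProduct.tmul_smul, TensorProduct.smul_tmul']
      refine congrArg (· ⊗ₜ[ℂ] x) (Subtype.ext (ContinuousLinearMap.ext fun z => ?_))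
      change inner ℂ ζ (c.1 (inner ℂ e z • ξ)) • e = inner ℂ ζ (c.1 ξ) • inner ℂ e z • e
      rw [map_smul, inner_smul_right, smul_smul, mul_comm]
    · rw [slice_tmul, map_smul]
      change inner ℂ ζ (f x • c.1 ξ) = _
      rw [inner_smul_right, smul_eq_mul, mul_comm]

variable [CompleteSpace L]

/-- The functionals on `E` that are bounded for the norm `x ↦ N (e e⋆ ⊗ x)`. -/
def boundedFunctionals (e : L) (N : Amp L E → ℝ) : Set (E →ₗ[ℂ] ℂ) :=
  {f | ∃ C : ℝ, 0 ≤ C ∧ ∀ x, ‖f x‖ ≤ C * N (rankOneCpt e e ⊗ₜ x)}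

/-- Bounded functionals are completely bounded. -/
theorem norm_slice_le {N : Amp L E → ℝ} (hN : IsQuantumNorm N) {e : L} (he : ‖e‖ = 1)
    {f : E →ₗ[ℂ] ℂ} {C : ℝ} (hC : 0 ≤ C) (hf : ∀ x, ‖f x‖ ≤ C * N (rankOneCpt e e ⊗ₜ x))
    (u : Amp L E) : ‖(slice (Cpt L) f u).1‖ ≤ C * N u := by
  have hN0 := hN.nonneg u
  refine ContinuousLinearMap.opNorm_le_bound _ (by positivity) fun ξ => ?_
  set ζ := (slice (Cpt L) f u).1 ξ with hζ
  obtain ⟨x, hx, hfx⟩ := exists_compression e ζ ξ u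
  have h1 : ‖ζ‖ * ‖ζ‖ = ‖f x‖ := by
    rw [← hfx f, ← hζ, inner_self_eq_norm_sq_to_K]
    simp [sq]
  have h2 : N (rankOneCpt e e ⊗ₜ x) ≤ ‖ζ‖ * (‖ξ‖ * N u) := by
    rw [← hx]
    refine (hN.ruanI _ _).1.trans ?_
    rw [InnerProductSpace.norm_rankOne, he, one_mul]
    refine mul_le_mul_of_nonneg_left ((hN.ruanI _ _).2.trans ?_) (norm_nonneg _)
    rw [InnerProductSpace.norm_rankOne, he, mul_one]
  by_cases h0 : ‖ζ‖ = 0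
  · rw [h0]; positivity
  · have hpos : 0 < ‖ζ‖ := (norm_nonneg _).lt_of_ne' h0
    refine le_of_mul_le_mul_left ?_ hpos
    calc ‖ζ‖ * ‖ζ‖ ≤ C * N (rankOneCpt e e ⊗ₜ x) := h1 ▸ hf x
      _ ≤ C * (‖ζ‖ * (‖ξ‖ * N u)) := mul_le_mul_of_nonneg_left h2 hC
      _ = ‖ζ‖ * (C * N u * ‖ξ‖) := by ring

theorem eq_zero_of_rankOneCpt_tmul {e : L} (he : ‖e‖ = 1) {x : E}
    (h : rankOneCpt e e ⊗ₜ[ℂ] x = 0) : x = 0 := by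
  refine (Module.forall_dual_apply_eq_zero_iff ℂ x).mp fun f => ?_
  have h1 := congrArg (fun t => ‖(slice (Cpt L) f t).1‖) h
  simpa [rankOneCpt, norm_smul, he] using h1

/-- By the Hahn–Banach theorem, the bounded functionals separate the points of `E`. -/
theorem boundedFunctionals_separate {N : Amp L E → ℝ} (hN : IsQuantumNorm N) {e : L}
    (he : ‖e‖ = 1) (x : E) (h : ∀ f ∈ boundedFunctionals e N, f x = 0) : x = 0 := by
  let : Norm E := ⟨fun x => N (rankOneCpt e e ⊗ₜ x)⟩
  have core : NormedSpace.Core ℂ E :=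
    { norm_nonneg := fun x => hN.nonneg _
      norm_smul := fun c x => by
        change N _ = _ * N _
        rw [TensorProduct.tmul_smul, hN.smul]
      norm_triangle := fun x y => by
        change N _ ≤ N _ + N _
        rw [TensorProduct.tmul_add]
        exact hN.add_le _ _
      norm_eq_zero_iff := fun x => by
        refine ⟨fun hx => eq_zero_of_rankOneCpt_tmul he (hN.eq_zero _ hx), fun hx => ?_⟩
        change N _ = 0
        rw [hx, TensorProduct.tmul_zero, hN.map_zero] }
  let := NormedAddCommGroup.ofCore core
  let := NormedSpace.ofCore core
  obtain ⟨g, -, hg⟩ := exists_dual_vector'' ℂ x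
  have h0 := h g.toLinearMap ⟨‖g‖, norm_nonneg g, fun y => g.le_opNorm y⟩
  refine (core.norm_eq_zero_iff x).mp ?_
  change g x = 0 at h0
  rw [h0] at hg
  exact RCLike.ofReal_eq_zero.mp hg.symm

omit [CompleteSpace L] in
theorem slice_strongAmp (f : E →ₗ[ℂ] ℂ) (g : F →ₗ[ℂ] ℂ) (u : Amp L E) (v : Amp L F) :
    (slice (Cpt L) (tensorFunctional f g) (strongAmp L (TensorProduct.mk ℂ E F) u v)).1 =
      (slice (Cpt L) f u).1 * (slice (Cpt L) g v).1 := by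
  induction u using TensorProduct.induction_on with
  | zero => simp
  | add u u' hu hu' =>
    simp only [map_add, LinearMap.add_apply, Submodule.coe_add, add_mul, hu, hu']
  | tmul a x =>
    induction v using TensorProduct.induction_on with
    | zero => simp
    | add v v' hv hv' => simp only [map_add, Submodule.coe_add, mul_add, hv, hv']
    | tmul b y =>
      rw [strongAmp_tmul, TensorProduct.mk_apply, slice_tmul, slice_tmul, slice_tmul,
        tensorFunctional_tmul]
      simp only [Submodule.coe_smul, smul_mul_smul_comm, mul_comm (f x)]
      rfl

/-- The Haagerup seminorm is definite: for bounded functionals `f` and `g` the slice by `f ⊗ g`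
sends `u ⊙ v` to the product of the slices of `u` and `v`, hence is bounded for it, and
such slices separate points. -/
theorem eq_zero_of_haagerup_eq_zero (hL : ¬ FiniteDimensional ℂ L) {nE : Amp L E → ℝ}
    {nF : Amp L F → ℝ} (hE : IsQuantumNorm nE) (hF : IsQuantumNorm nF) (U : Amp L (E ⊗[ℂ] F))
    (hU : haagerup nE nF U = 0) : U = 0 := by
  have : Nontrivial L := by
    by_contra h
    rw [not_nontrivial_iff_subsingleton] at h
    exact hL inferInstance
  obtain ⟨e, he⟩ := exists_norm_eq L zero_le_one
  refine eq_zero_of_forall_slice (Φ := {φ | ∃ f ∈ boundedFunctionals e nE,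
    ∃ g ∈ boundedFunctionals e nF, φ = tensorFunctional f g}) ?_ U ?_
  · intro z hz
    refine eq_zero_of_forall_slice (boundedFunctionals_separate hF he) z fun g hg => ?_
    exact boundedFunctionals_separate hE he _ fun f hf => hz _ ⟨f, hf, g, hg, rfl⟩
  · rintro _ ⟨f, ⟨C, hC, hf⟩, g, ⟨D, hD, hg⟩, rfl⟩
    apply Subtype.ext
    change (slice (Cpt L) (tensorFunctional f g) U).1 = 0
    rw [← norm_le_zero_iff, ← mul_zero (C * D), ← hU]
    refine le_mul_haagerup hL hE hF (mul_nonneg hC hD) ?_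
    rintro u v rfl
    rw [slice_strongAmp, mul_mul_mul_comm]
    exact (norm_mul_le _ _).trans (mul_le_mul (norm_slice_le hE he hC hf u)
      (norm_slice_le hF he hD hg v) (norm_nonneg _) (mul_nonneg hC (hE.nonneg u)))

theorem isQuantumNorm_haagerup (hL : ¬ FiniteDimensional ℂ L) {nE : Amp L E → ℝ}
    {nF : Amp L F → ℝ} (hE : IsQuantumNorm nE) (hF : IsQuantumNorm nF) :
    IsQuantumNorm (haagerup nE nF) where
  nonneg := haagerup_nonneg hE hF
  add_le := haagerup_add_le hL hE hF
  smul := haagerup_smul hL hE hF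
  eq_zero := eq_zero_of_haagerup_eq_zero hL hE hF
  ruanI := haagerup_ruanI hL hE hF
  ruanII := haagerup_ruanII hL hE hF

end Definite

/-! ### Linearization of bilinear operators -/

section Universal

variable {L : Type*} [NormedAddCommGroup L] [InnerProductSpace ℂ L]
variable {E : Type*} [AddCommGroup E] [Module ℂ E]
variable {F : Type*} [AddCommGroup F] [Module ℂ F]
variable {G : Type*} [AddCommGroup G] [Module ℂ G]

theorem amp_lift_strongAmp (R : E →ₗ[ℂ] F →ₗ[ℂ] G) (u : Amp L E) (v : Amp L F) :
    amp L (TensorProduct.lift R) (strongAmp L (TensorProduct.mk ℂ E F) u v) =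
      strongAmp L R u v := by
  induction u using TensorProduct.induction_on with
  | zero => simp
  | add u u' hu hu' => simp only [map_add, LinearMap.add_apply, hu, hu']
  | tmul a x =>
    induction v using TensorProduct.induction_on with
    | zero => simp
    | add v v' hv hv' => simp only [map_add, hv, hv']
    | tmul b y => simp [strongAmp_tmul, amp]

variable [CompleteSpace L]

/-- A bilinear operator and its linearization have the same bounds. -/
theorem cbBound_lift_iff (hL : ¬ FiniteDimensional ℂ L) {nE : Amp L E → ℝ} {nF : Amp L F → ℝ}
    (hE : IsQuantumNorm nE) (hF : IsQuantumNorm nF) {nG : Amp L G → ℝ}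
    (R : E →ₗ[ℂ] F →ₗ[ℂ] G) (C : ℝ) :
    CBBound (haagerup nE nF) nG (TensorProduct.lift R) C ↔ SCBBound nE nF nG R C := by
  refine and_congr_right fun hC => ⟨fun h u v => ?_, fun h U => ?_⟩
  · rw [← amp_lift_strongAmp, mul_assoc]
    exact (h _).trans (mul_le_mul_of_nonneg_left (haagerup_strongAmp_le hE hF u v) hC)
  · refine le_mul_haagerup hL hE hF hC ?_
    rintro u v rfl
    rw [amp_lift_strongAmp, ← mul_assoc]
    exact h u v

end Universal
end QuantumSpace

theorem theorem2
    {L : Type uL} [NormedAddCommGroup L] [InnerProductSpace ℂ L] [CompleteSpace L]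
    [TopologicalSpace.SeparableSpace L] (hL : ¬ FiniteDimensional ℂ L)
    {E : Type uE} [AddCommGroup E] [Module ℂ E]
    {F : Type uF} [AddCommGroup F] [Module ℂ F]
    (nE : QuantumSpace.Amp L E → ℝ) (hE : QuantumSpace.IsQuantumNorm nE)
    (nF : QuantumSpace.Amp L F → ℝ) (hF : QuantumSpace.IsQuantumNorm nF) :
    -- the Effros symbol is surjective, and the Haagerup seminorm is a quantum norm
    Function.Surjective (QuantumSpace.effros L E F) ∧
    QuantumSpace.IsQuantumNorm (QuantumSpace.haagerup nE nF) ∧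
    -- factorization of strongly completely bounded bilinear operators
    (∀ (G : Type uG) [AddCommGroup G] [Module ℂ G]
      (nG : QuantumSpace.Amp L G → ℝ), QuantumSpace.IsQuantumNorm nG →
      ∀ R : E →ₗ[ℂ] F →ₗ[ℂ] G, QuantumSpace.IsSCB nE nF nG R →
        ∃ S : E ⊗[ℂ] F →ₗ[ℂ] G,
          (QuantumSpace.IsCB (QuantumSpace.haagerup nE nF) nG S ∧
            ∀ x y, S (x ⊗ₜ[ℂ] y) = R x y) ∧
          (∀ S' : E ⊗[ℂ] F →ₗ[ℂ] G,
            QuantumSpace.IsCB (QuantumSpace.haagerup nE nF) nG S' →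
            (∀ x y, S' (x ⊗ₜ[ℂ] y) = R x y) → S' = S) ∧
          QuantumSpace.cbNorm (QuantumSpace.haagerup nE nF) nG S =
            QuantumSpace.scbNorm nE nF nG R) ∧
    -- the universal property
    QuantumSpace.IsHaagerupTensorProduct.{w} nE nF (QuantumSpace.haagerup nE nF)
      (TensorProduct.mk ℂ E F) := by
  have hq := QuantumSpace.isQuantumNorm_haagerup hL hE hF
  refine ⟨QuantumSpace.effros_surjective E F, hq, ?_, hq,
    QuantumSpace.haagerup_strongAmp_le hE hF, ?_⟩
  · intro G _ _ nG _ R hR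
    refine ⟨TensorProduct.lift R, ⟨?_, fun x y => TensorProduct.lift.tmul x y⟩,
      fun S' _ h => TensorProduct.ext' fun x y => by rw [h, TensorProduct.lift.tmul], ?_⟩
    · exact hR.imp fun C hC => (QuantumSpace.cbBound_lift_iff hL hE hF R C).mpr hC
    · exact congrArg sInf (Set.ext fun C => QuantumSpace.cbBound_lift_iff hL hE hF R C)
  · intro G _ _ nG _ R hR
    refine ⟨TensorProduct.lift R, ⟨fun U => ?_, fun x y => TensorProduct.lift.tmul x y⟩,
      fun S' h => TensorProduct.ext' fun x y => ?_⟩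
    · have := (QuantumSpace.cbBound_lift_iff hL hE hF R 1).mpr
        ⟨zero_le_one, fun u v => by rw [one_mul]; exact hR u v⟩
      simpa using this.2 U
    · rw [TensorProduct.lift.tmul]
      exact h.2 x y
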